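/- Let $(M,d)$ be a compact metric space. A Lipschitz function $f\colon M\to\mathbb{R}$ is called locally flat if for every $p\in M$ $$\lim_{x,y\to p,\ x\neq y}\frac{|f(x)-f(y)|}{d(x,y)}=0 .$$ The locally flat Lipschitz functions on $M$ are said to separate points uniformly if there is $C\in[1,\infty)$ such that for all $x,y\in M$ there is a locally flat $C$-Lipschitz function $f\colon M\to\mathbb{R}$ with $f(x)-f(y)=d(x,y)$. The space $M$ is called purely 1-unrectifiable if for every $A\subseteq\mathbb{R}$ and every Lipschitz map $f\colon A\to M$ the Hausdorff 1-measure of $f(A)$ is $0$. (1) The locally flat Lipschitz functions on $M$ separate points uniformly if and only if $M$ is purely 1-unrectifiable. (2) If $M$ is purely 1-unrectifiable, then for every $p\in M$ and every $\delta>0$ there is a locally flat 1-Lipschitz function $g\colon M\to\mathbb{R}$ such that $g(x)-g(p)\geq d(p,x)-\delta$ for every $x\in M$. -/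

import Mathlib

open Set Filter Topology MeasureTheory
open scoped NNReal

/-- A real function `f` on a metric space is locally flat if, for every point `p`,
`|f x - f y| / d(x, y)` tends to `0` as the distinct points `x`, `y` tend to `p`. (Being Lipschitz
is always required separately.) -/
def IsLocallyFlat {M : Type*} [MetricSpace M] (f : M → ℝ) : Prop :=
  ∀ p : M, Tendsto (fun z : M × M => |f z.1 - f z.2| / dist z.1 z.2)
    (𝓝[{z : M × M | z.1 ≠ z.2}] (p, p)) (𝓝 0)

/-- The locally flat Lipschitz functions on `M` separate points uniformly. -/
def LocallyFlatSeparatesPointsUniformly (M : Type*) [MetricSpace M] : Prop :=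
  ∃ C : ℝ≥0, 1 ≤ C ∧ ∀ x y : M, ∃ f : M → ℝ,
    LipschitzWith C f ∧ IsLocallyFlat f ∧ f x - f y = dist x y

/-- `M` is purely 1-unrectifiable: every Lipschitz image in `M` of a subset of the real line has
zero Hausdorff 1-measure. -/
def IsPurelyOneUnrectifiable (M : Type*) [MetricSpace M] [MeasurableSpace M] [BorelSpace M] :
    Prop :=
  ∀ (A : Set ℝ) (f : A → M) (K : ℝ≥0), LipschitzWith K f →
    Measure.hausdorffMeasure 1 (range f) = 0

/-!
Both halves compare the increment of a real function with the Lebesgue measure of the values it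
takes: a Lipschitz function maps `H¹`-null sets to null sets of values, so whatever it gains has to
be gained elsewhere, and there it costs length.

*Pure unrectifiability gives locally flat functions.* Start from the metric `D = d` and lower the
price of every jump shorter than `r` to `ε` times its length; the cheapest chains of jumps define a
smaller metric `D.shortcut ε r`. The key point (`SmallerDist.exists_forall_le_shortcut_add`) is that
for small `r` this hardly affects the distances to a fixed point `p`. If it did for arbitrarily
small `r`, there would be chains of bounded length that are too cheap; parametrized by arc length
they are graphs of `1`-Lipschitz maps over finite sets of reals, and by compactness of the
hyperspace they converge to the graph of a `1`-Lipschitz map over a set of reals. Its image is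
`H¹`-null by hypothesis, hence so is the set of values of `D p` on it. The chains then take all their
values of `D p` in a neighbourhood of tiny measure of this null set, and so do the cheap jumps in
between; therefore the fully charged jumps must cover almost all of `[0, D p x]`, and the chain is
not too cheap. Iterating with ever smaller `ε` and taking the limit of the functions `D p`
yields a function that is uniformly locally flat and close to `d p`.

*Locally flat functions prevent rectifiable pieces.* Let `γ` be a Lipschitz map from a closed set `B`
of reals to `M`, and `g` locally flat and `C`-Lipschitz. Then `g ∘ γ` is infinitesimally constant
on `B`, so by a Sard type argument (`hausdorffMeasure_image_eq_zero_of_flat`) it can only grow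
across the gaps of `B`. Near a density point `t` of `B` the gaps are negligible, uniformly in `g`, so
uniform separation of points forces `γ` itself to be infinitesimally constant at `t`. The same
Sard type argument then shows that the image of `γ` is `H¹`-null.
-/

/-! ### Costs of finite chains -/

/-- The total cost of the finite chain that runs from `x` through the points of `l` to `y`, where a
jump from `u` to `v` costs `c u v`. The list form is the one of `PseudoMetricSpace.ofPreNNDist`. -/
def chainCost {M : Type*} (c : M → M → ℝ≥0) (x : M) (l : List M) (y : M) : ℝ≥0 :=
  ((x :: l).zipWith c (l ++ [y])).sum

section chainCost

variable {M : Type*}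

@[simp]
lemma chainCost_nil (c : M → M → ℝ≥0) (x y : M) : chainCost c x [] y = c x y := by
  simp [chainCost]

@[simp]
lemma chainCost_cons (c : M → M → ℝ≥0) (x a : M) (l : List M) (y : M) :
    chainCost c x (a :: l) y = c x a + chainCost c a l y := by
  simp [chainCost]

lemma le_chainCost {c N : M → M → ℝ≥0} (tri : ∀ x y z, N x z ≤ N x y + N y z)
    (h : ∀ x y, N x y ≤ c x y) (x : M) (l : List M) (y : M) : N x y ≤ chainCost c x l y := by
  induction l generalizing x with
  | nil => simpa using h x y
  | cons a l ih =>
    rw [chainCost_cons]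
    exact (tri x a y).trans (add_le_add (h x a) (ih a))

lemma mul_chainCost_le {c N : M → M → ℝ≥0} {κ : ℝ≥0}
    (h : ∀ x y, κ * N x y ≤ c x y) (x : M) (l : List M) (y : M) :
    κ * chainCost N x l y ≤ chainCost c x l y := by
  induction l generalizing x with
  | nil => simpa using h x y
  | cons a l ih =>
    rw [chainCost_cons, chainCost_cons, mul_add]
    exact add_le_add (h x a) (ih a)

/-- A chain parametrized by arc length: its points, paired with the length of the chain up to them,
form the graph of a `1`-Lipschitz map defined on a finite set of reals. -/
lemma exists_finite_graph_of_chain [MetricSpace M] (x : M) (l : List M) (y : M) :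
    ∃ S : Set (ℝ × M), S.Finite ∧ ((0 : ℝ), x) ∈ S ∧
      (∀ z ∈ S, z.1 ∈ Icc (0 : ℝ) (chainCost nndist x l y)) ∧
      (∀ z ∈ S, ∀ w ∈ S, dist z.2 w.2 ≤ |z.1 - w.1|) ∧
      ∀ u ∈ x :: (l ++ [y]), u ∈ Prod.snd '' S := by
  induction l generalizing x with
  | nil =>
    refine ⟨{(0, x), (dist x y, y)}, by simp, by simp, ?_, ?_, ?_⟩
    · rintro z (rfl | rfl) <;> simp
    · rintro z (rfl | rfl) w (rfl | rfl) <;> simp [dist_comm]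
    · intro u hu
      rcases (by simpa using hu : u = x ∨ u = y) with rfl | rfl
      · exact ⟨_, Or.inl rfl, rfl⟩
      · exact ⟨_, Or.inr rfl, rfl⟩
  | cons a l ih =>
    obtain ⟨S, hfin, h0, hI, hlip, hmem⟩ := ih a
    have key : ∀ w ∈ S, dist x w.2 ≤ dist x a + w.1 := fun w hw => by
      have h := hlip _ h0 w hw
      simp only [zero_sub, abs_neg, abs_of_nonneg (hI w hw).1] at h
      linarith [dist_triangle x a w.2]
    refine ⟨insert (0, x) ((fun z : ℝ × M => (dist x a + z.1, z.2)) '' S),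
      (hfin.image _).insert _, mem_insert _ _, ?_, ?_, ?_⟩
    · rintro z (rfl | ⟨z, hz, rfl⟩)
      · exact ⟨le_rfl, NNReal.coe_nonneg _⟩
      · have := hI z hz
        have hd : (0 : ℝ) ≤ dist x a := dist_nonneg
        simp only [mem_Icc, chainCost_cons, NNReal.coe_add, coe_nndist] at this ⊢
        constructor <;> linarith
    · rintro z (rfl | ⟨z, hz, rfl⟩) w (rfl | ⟨w, hw, rfl⟩)
      · simp
      · have hd : (0 : ℝ) ≤ dist x a := dist_nonneg
        simp only [zero_sub, abs_neg]
        rw [abs_of_nonneg (by linarith [(hI w hw).1])]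
        exact key w hw
      · have hd : (0 : ℝ) ≤ dist x a := dist_nonneg
        simp only [sub_zero]
        rw [abs_of_nonneg (by linarith [(hI z hz).1]), dist_comm]
        exact key z hz
      · simpa using hlip z hz w hw
    · intro u hu
      rcases List.mem_cons.1 hu with rfl | hu
      · exact ⟨_, mem_insert _ _, rfl⟩
      · obtain ⟨z, hz, rfl⟩ := hmem u hu
        exact ⟨_, Or.inr ⟨z, hz, rfl⟩, rfl⟩

/-- Along a chain, `F` has to cross every value between `F x` and `F y`; hence those outside `V`
are paid for, if each single jump pays for the values outside `V` that it crosses. -/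
lemma volume_uIcc_diff_le_chainCost (c : M → M → ℝ≥0) (F : M → ℝ) (V : Set ℝ) (x : M) (l : List M)
    (y : M) (h : ∀ u ∈ x :: (l ++ [y]), ∀ v ∈ x :: (l ++ [y]),
      volume (uIcc (F u) (F v) \ V) ≤ c u v) :
    volume (uIcc (F x) (F y) \ V) ≤ chainCost c x l y := by
  induction l generalizing x with
  | nil => simpa using h x (by simp) y (by simp)
  | cons a l ih =>
    have hsub : uIcc (F x) (F y) \ V ⊆ (uIcc (F x) (F a) \ V) ∪ (uIcc (F a) (F y) \ V) := by
      rw [← union_sdiff_distrib]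
      exact sdiff_subset_sdiff_left uIcc_subset_uIcc_union_uIcc
    rw [chainCost_cons, ENNReal.coe_add]
    refine (measure_mono hsub).trans ((measure_union_le _ _).trans (add_le_add ?_ ?_))
    · exact h x (by simp) a (by simp)
    · exact ih a fun u hu v hv => h u (List.mem_cons_of_mem _ hu) v (List.mem_cons_of_mem _ hv)

end chainCost

/-! ### Limits of chains of bounded length -/

/-- Blaschke's selection theorem in `[0, L] × M`, for graphs of `1`-Lipschitz maps: along a
subsequence, the images of such maps accumulate only on the image of another one. -/
lemma exists_compact_graph_of_seq {M : Type*} [MetricSpace M] [CompactSpace M] (L : ℝ)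
    (S : ℕ → Set (ℝ × M)) (hfin : ∀ n, (S n).Finite) (hne : ∀ n, (S n).Nonempty)
    (hI : ∀ n, ∀ z ∈ S n, z.1 ∈ Icc 0 L)
    (hlip : ∀ n, ∀ z ∈ S n, ∀ w ∈ S n, dist z.2 w.2 ≤ |z.1 - w.1|) :
    ∃ T : Set (ℝ × M), IsCompact T ∧ (∀ z ∈ T, ∀ w ∈ T, dist z.2 w.2 ≤ |z.1 - w.1|) ∧
      ∃ φ : ℕ → ℕ, StrictMono φ ∧ ∀ η > 0, ∀ᶠ n in atTop, ∀ z ∈ S (φ n), ∃ w ∈ T,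
        dist z.2 w.2 < η := by
  let ι : Icc (0 : ℝ) L × M → ℝ × M := fun z => (z.1, z.2)
  have hι : Isometry ι := isometry_subtype_coe.prodMap isometry_id
  let G : ℕ → TopologicalSpace.NonemptyCompacts (Icc (0 : ℝ) L × M) := fun n =>
    ⟨⟨ι ⁻¹' S n, ((hfin n).preimage hι.injective.injOn).isCompact⟩, by
      obtain ⟨z, hz⟩ := hne n
      exact ⟨(⟨z.1, hI n z hz⟩, z.2), hz⟩⟩
  obtain ⟨T, φ, hφ, hT⟩ := CompactSpace.tendsto_subseq G
  have hclose : ∀ η > 0, ∀ᶠ n in atTop,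
      Metric.hausdorffDist (G (φ n) : Set (Icc (0 : ℝ) L × M)) T < η := fun η hη => by
    filter_upwards [(Metric.tendsto_nhds.1 hT) η hη] with n hn
    simpa [Metric.NonemptyCompacts.dist_eq] using hn
  have hfinite : ∀ n, Metric.hausdorffEDist (G n : Set (Icc (0 : ℝ) L × M)) T ≠ ⊤ := fun n =>
    Metric.hausdorffEDist_ne_top_of_nonempty_of_bounded (G n).nonempty T.nonempty
      (G n).isCompact.isBounded T.isCompact.isBounded
  refine ⟨ι '' T, T.isCompact.image hι.continuous, ?_, φ, hφ, ?_⟩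
  · rintro _ ⟨z, hz, rfl⟩ _ ⟨w, hw, rfl⟩
    refine le_of_forall_pos_le_add fun η hη => ?_
    obtain ⟨n, hn⟩ := (hclose (η / 4) (by positivity)).exists
    obtain ⟨z', hz', hzz⟩ := Metric.exists_dist_lt_of_hausdorffDist_lt' hz hn (hfinite _)
    obtain ⟨w', hw', hww⟩ := Metric.exists_dist_lt_of_hausdorffDist_lt' hw hn (hfinite _)
    have h := hlip _ _ hz' _ hw'
    simp only [ι] at h ⊢
    rw [Prod.dist_eq, max_lt_iff, Subtype.dist_eq, Real.dist_eq] at hzz hww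
    have h1 := dist_triangle4 z.2 z'.2 w'.2 w.2
    rw [dist_comm z.2 z'.2] at h1
    have h2 : |(z'.1 : ℝ) - w'.1| ≤ |(z'.1 : ℝ) - z.1| + |(z.1 : ℝ) - w.1| + |(w'.1 : ℝ) - w.1| := by
      rw [abs_sub_comm (w'.1 : ℝ)]
      have : (z'.1 : ℝ) - w'.1 = (z'.1 - z.1) + (z.1 - w.1) + (w.1 - w'.1) := by ring
      rw [this]
      exact abs_add_three _ _ _
    linarith [hzz.1, hzz.2, hww.1, hww.2]
  · intro η hη
    filter_upwards [hclose η hη] with n hn z hz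
    obtain ⟨w, hw, hzw⟩ := Metric.exists_dist_lt_of_hausdorffDist_lt
      (x := ((⟨z.1, hI _ z hz⟩ : Icc (0 : ℝ) L), z.2)) (show _ ∈ ι ⁻¹' S (φ n) from hz) hn
      (hfinite _)
    exact ⟨ι w, ⟨w, hw, rfl⟩, (le_max_right _ _).trans_lt hzw⟩

/-- Pure unrectifiability, for Lipschitz maps given by their graphs. -/
lemma IsPurelyOneUnrectifiable.hausdorffMeasure_snd_image {M : Type*} [MetricSpace M]
    [MeasurableSpace M] [BorelSpace M] (hM : IsPurelyOneUnrectifiable M) {T : Set (ℝ × M)}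
    (hT : ∀ z ∈ T, ∀ w ∈ T, dist z.2 w.2 ≤ |z.1 - w.1|) :
    Measure.hausdorffMeasure 1 (Prod.snd '' T) = 0 := by
  have hex : ∀ t : Prod.fst '' T, ∃ u : M, ((t : ℝ), u) ∈ T := by
    rintro ⟨_, z, hz, rfl⟩
    exact ⟨z.2, hz⟩
  choose f hf using hex
  refine measure_mono_null ?_ (hM _ f 1 (LipschitzWith.of_dist_le_mul fun s t => ?_))
  · rintro _ ⟨z, hz, rfl⟩
    refine ⟨⟨z.1, z, hz, rfl⟩, ?_⟩
    have := hT _ (hf ⟨z.1, z, hz, rfl⟩) _ hz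
    simpa using this
  · simpa [Subtype.dist_eq, Real.dist_eq] using hT _ (hf s) _ (hf t)

/-! ### Distances with cheap short jumps -/

/-- A metric `D ≤ d` on `M` that is bi-Lipschitz equivalent to the given metric `d`. -/
structure SmallerDist (M : Type*) [MetricSpace M] where
  /-- The distance function. -/
  toFun : M → M → ℝ≥0
  self : ∀ x, toFun x x = 0
  comm : ∀ x y, toFun x y = toFun y x
  triangle : ∀ x y z, toFun x z ≤ toFun x y + toFun y z
  le_nndist : ∀ x y, toFun x y ≤ nndist x y
  exists_mul_nndist_le : ∃ κ > 0, ∀ x y, κ * nndist x y ≤ toFun x y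

namespace SmallerDist

variable {M : Type*} [MetricSpace M]

instance : CoeFun (SmallerDist M) fun _ => M → M → ℝ≥0 := ⟨toFun⟩

/-- The price of a single jump, if jumps shorter than `r` are charged only `ε` times their
length. -/
noncomputable def cost (D : SmallerDist M) (ε r : ℝ≥0) (x y : M) : ℝ≥0 :=
  if nndist x y < r then ε * nndist x y else D x y

lemma abs_sub_le (D : SmallerDist M) (p x y : M) : |(D p x : ℝ) - D p y| ≤ D x y := by
  have h1 : (D p x : ℝ) ≤ D p y + D y x := mod_cast D.triangle p y x
  have h2 : (D p y : ℝ) ≤ D p x + D x y := mod_cast D.triangle p x y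
  rw [D.comm y x] at h1
  rw [_root_.abs_sub_le_iff]
  constructor <;> linarith

lemma cost_le {D : SmallerDist M} {ε : ℝ≥0} (hε : ∀ x y, ε * nndist x y ≤ D x y) (r : ℝ≥0)
    (x y : M) : D.cost ε r x y ≤ D x y := by
  rw [cost]; split_ifs
  · exact hε x y
  · exact le_rfl

lemma le_cost {D : SmallerDist M} {ε : ℝ≥0} (hε : ∀ x y, ε * nndist x y ≤ D x y) (r : ℝ≥0)
    (x y : M) : ε * nndist x y ≤ D.cost ε r x y := by
  rw [cost]; split_ifs
  · exact le_rfl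
  · exact hε x y

/-- The largest distance for which a jump from `x` to `y` costs at most `D.cost ε r x y`. -/
noncomputable def shortcut (D : SmallerDist M) (ε r : ℝ≥0) (hε0 : 0 < ε)
    (hε : ∀ x y, ε * nndist x y ≤ D x y) : SmallerDist M :=
  have hself : ∀ x, D.cost ε r x x = 0 := fun x => by simp [cost, D.self]
  have hcomm : ∀ x y, D.cost ε r x y = D.cost ε r y x := fun x y => by
    rw [cost, cost, nndist_comm x y, D.comm x y]
  have htri : ∀ x y z : M, ε * nndist x z ≤ ε * nndist x y + ε * nndist y z := fun x y z => by
    rw [← mul_add]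
    gcongr
    exact nndist_triangle x y z
  let P := PseudoMetricSpace.ofPreNNDist (D.cost ε r) hself hcomm
  { toFun x y := ⨅ l : List M, chainCost (D.cost ε r) x l y
    self x := NNReal.coe_injective (P.dist_self x)
    comm x y := NNReal.coe_injective (P.dist_comm x y)
    triangle x y z := NNReal.coe_le_coe.1 (P.dist_triangle x y z)
    le_nndist x y :=
      (ciInf_le (OrderBot.bddBelow _) []).trans <| by
        rw [chainCost_nil]
        exact (cost_le hε r x y).trans (D.le_nndist x y)
    exists_mul_nndist_le := ⟨ε, hε0, fun x y => le_ciInf fun l =>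
      le_chainCost htri (le_cost hε r) x l y⟩ }

lemma shortcut_le_cost (D : SmallerDist M) (ε r : ℝ≥0) (hε0 : 0 < ε)
    (hε : ∀ x y, ε * nndist x y ≤ D x y) (x y : M) :
    D.shortcut ε r hε0 hε x y ≤ D.cost ε r x y :=
  (ciInf_le (f := fun l => chainCost (D.cost ε r) x l y) (OrderBot.bddBelow _) []).trans
    (chainCost_nil _ _ _).le

/-- In a compact purely `1`-unrectifiable space, making sufficiently short jumps cheap shortens the
distances to `p` by at most `δ`. Otherwise there are chains of bounded length that are too cheap
although the jumps offered below price become shorter and shorter. These chains accumulate on a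
Lipschitz image of a set of reals, whose image under `D p` is null. A neighbourhood `V` of this null
set, of measure less than `δ`, contains all values that the cheap jumps cross, so the other jumps
have to pay for the whole of `[0, D p x] \ V`. -/
theorem exists_forall_le_shortcut_add [CompactSpace M] [MeasurableSpace M] [BorelSpace M]
    (hM : IsPurelyOneUnrectifiable M) (D : SmallerDist M) (p : M) {ε δ : ℝ≥0} (hε0 : 0 < ε)
    (hδ : 0 < δ) (hε : ∀ x y, ε * nndist x y ≤ D x y) :
    ∃ r > 0, ∀ x, D p x ≤ D.shortcut ε r hε0 hε p x + δ := by
  by_contra! hcon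
  have hchain : ∀ n : ℕ, ∃ x l, chainCost (D.cost ε (1 / ((n : ℝ≥0) + 1))) p l x + δ < D p x := by
    intro n
    obtain ⟨x, hx⟩ := hcon (1 / ((n : ℝ≥0) + 1)) (by positivity)
    obtain ⟨l, hl⟩ := exists_lt_of_ciInf_lt
      (f := fun l => chainCost (D.cost ε (1 / ((n : ℝ≥0) + 1))) p l x) (lt_tsub_iff_right.2 hx)
    exact ⟨x, l, lt_tsub_iff_right.1 hl⟩
  choose x l hxl using hchain
  obtain ⟨R, hR⟩ := Metric.isBounded_iff_nndist.1 (isCompact_univ (X := M)).isBounded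
  have hlen : ∀ n, chainCost nndist p (l n) (x n) ≤ R / ε := fun n => by
    rw [le_div_iff₀ hε0, mul_comm]
    calc ε * chainCost nndist p (l n) (x n) ≤ _ := mul_chainCost_le (le_cost hε _) _ _ _
      _ ≤ _ := (le_self_add.trans (hxl n).le)
      _ ≤ nndist p (x n) := D.le_nndist _ _
      _ ≤ R := hR (mem_univ _) (mem_univ _)
  choose S hfin h0 hI hlip hmem using fun n => exists_finite_graph_of_chain p (l n) (x n)
  obtain ⟨T, hTc, hTlip, φ, hφ, hT⟩ := exists_compact_graph_of_seq (R / ε : ℝ≥0) S hfin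
    (fun n => ⟨_, h0 n⟩)
    (fun n z hz => ⟨(hI n z hz).1, (hI n z hz).2.trans (NNReal.coe_le_coe.2 (hlen n))⟩) hlip
  let F : M → ℝ := fun y => D p y
  have hF : LipschitzWith 1 F := LipschitzWith.of_dist_le_mul fun y z => by
    rw [Real.dist_eq, NNReal.coe_one, one_mul]
    exact (D.abs_sub_le p y z).trans (mod_cast D.le_nndist y z)
  let Z : Set ℝ := F '' (Prod.snd '' T)
  have hZc : IsCompact Z := (hTc.image continuous_snd).image hF.continuous
  have hZ0 : volume Z = 0 := by
    have := hF.hausdorffMeasure_image_le zero_le_one (Prod.snd '' T)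
    rw [hM.hausdorffMeasure_snd_image hTlip, mul_zero, nonpos_iff_eq_zero] at this
    rwa [← hausdorffMeasure_real]
  obtain ⟨η, hη, hVη⟩ : ∃ η > 0, volume (Metric.thickening η Z) < δ := by
    have hlim := tendsto_measure_thickening (μ := volume) (s := Z)
      ⟨1, one_pos, (hZc.isBounded.thickening (δ := 1)).measure_lt_top.ne⟩
    rw [hZc.isClosed.closure_eq, hZ0] at hlim
    obtain ⟨η, hη1, hη2⟩ := ((hlim.eventually_lt_const (u := (δ : ENNReal))
      (by simpa using hδ)).and self_mem_nhdsWithin).exists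
    exact ⟨η, hη2, hη1⟩
  set V := Metric.thickening η Z
  -- Half of `η` is for the chain points to be near `Z`, half for the cheap jumps.
  obtain ⟨n, hn1, hn2⟩ := ((hT (η / 2) (by positivity)).and
    (hφ.tendsto_atTop.eventually
      ((tendsto_one_div_add_atTop_nhds_zero_nat (𝕜 := ℝ)).eventually_lt_const (show (0 : ℝ) < η / 2 by positivity)))).exists
  have hpay := volume_uIcc_diff_le_chainCost (D.cost ε (1 / (((φ n : ℕ) : ℝ≥0) + 1))) F V p
    (l (φ n)) (x (φ n)) (by
      intro u hu v _
      rw [cost]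
      split_ifs with huv
      · have hsub : uIcc (F u) (F v) ⊆ V := by
          obtain ⟨z, hz, rfl⟩ := hmem _ u hu
          obtain ⟨w, hw, hzw⟩ := hn1 z hz
          intro t ht
          refine Metric.mem_thickening_iff.2 ⟨F w.2, ⟨_, ⟨w, hw, rfl⟩, rfl⟩, ?_⟩
          have h1 : |t - F z.2| ≤ |F v - F z.2| := abs_sub_left_of_mem_uIcc ht
          have h2 := hF.dist_le_mul v z.2
          have h3 := hF.dist_le_mul z.2 w.2
          have h4 : dist z.2 v < 1 / ((φ n : ℝ) + 1) := mod_cast huv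
          rw [NNReal.coe_one, one_mul] at h2 h3
          rw [Real.dist_eq, dist_comm v] at h2
          calc dist t (F w.2) ≤ dist t (F z.2) + dist (F z.2) (F w.2) := dist_triangle _ _ _
            _ < η := by rw [Real.dist_eq]; linarith
        rw [sdiff_eq_empty.2 hsub]
        simp
      · refine (measure_mono sdiff_subset).trans ?_
        rw [Real.volume_interval, abs_sub_comm, ← ENNReal.ofReal_coe_nnreal]
        exact ENNReal.ofReal_le_ofReal (D.abs_sub_le p u v))
  have hFp : F p = 0 := by simp [F, D.self]
  have htot : (D p (x (φ n)) : ENNReal) ≤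
      chainCost (D.cost ε (1 / (((φ n : ℕ) : ℝ≥0) + 1))) p (l (φ n)) (x (φ n)) + δ := by
    calc (D p (x (φ n)) : ENNReal) = volume (uIcc (F p) (F (x (φ n)))) := by
          rw [Real.volume_interval, hFp, sub_zero, abs_of_nonneg (NNReal.coe_nonneg _),
            ENNReal.ofReal_coe_nnreal]
      _ ≤ volume (uIcc (F p) (F (x (φ n))) \ V) + volume V :=
          (measure_mono (by simp)).trans (measure_union_le _ _)
      _ ≤ _ := add_le_add hpay hVη.le
  exact absurd (hxl (φ n)) (not_lt.2 (mod_cast htot))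

/-- One step of the iteration that makes short jumps ever cheaper. -/
lemma exists_le_of_isPurelyOneUnrectifiable [CompactSpace M] [MeasurableSpace M] [BorelSpace M]
    (hM : IsPurelyOneUnrectifiable M) (D : SmallerDist M) (p : M) {ε δ : ℝ≥0} (hε : 0 < ε)
    (hδ : 0 < δ) :
    ∃ D' : SmallerDist M, (∀ x y, D' x y ≤ D x y) ∧
      (∃ r > 0, ∀ x y, nndist x y < r → D' x y ≤ ε * nndist x y) ∧ ∀ x, D p x ≤ D' p x + δ := by
  obtain ⟨κ, hκ0, hκ⟩ := D.exists_mul_nndist_le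
  have hm : ∀ x y, min ε κ * nndist x y ≤ D x y := fun x y =>
    (mul_le_mul_left (min_le_right ε κ) _).trans (hκ x y)
  obtain ⟨r, hr, h⟩ := exists_forall_le_shortcut_add hM D p (lt_min hε hκ0) hδ hm
  refine ⟨D.shortcut (min ε κ) r (lt_min hε hκ0) hm, fun x y => ?_, ⟨r, hr, fun x y hxy => ?_⟩, h⟩
  · exact (D.shortcut_le_cost _ _ _ _ x y).trans (cost_le hm r x y)
  · refine (D.shortcut_le_cost _ _ _ _ x y).trans ?_
    rw [cost, if_pos hxy]
    gcongr
    exact min_le_left _ _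

end SmallerDist

/-- In a compact purely `1`-unrectifiable space, the distance to a point can be approximated from
below by a locally flat `1`-Lipschitz function: the limit of the distances `D k p` for a decreasing
sequence of metrics `D k`, in which short jumps become ever cheaper. -/
theorem IsPurelyOneUnrectifiable.exists_isLocallyFlat {M : Type*} [MetricSpace M] [CompactSpace M]
    [MeasurableSpace M] [BorelSpace M] (hM : IsPurelyOneUnrectifiable M) (p : M) {δ : ℝ}
    (hδ : 0 < δ) :
    ∃ g : M → ℝ, LipschitzWith 1 g ∧ IsLocallyFlat g ∧ ∀ x : M, g x - g p ≥ dist p x - δ := by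
  lift δ to ℝ≥0 using hδ.le
  have hδ' : 0 < δ := mod_cast hδ
  choose next hle hflat hclose using fun (k : ℕ) (D : SmallerDist M) =>
    D.exists_le_of_isPurelyOneUnrectifiable hM p (ε := (1 / 2) ^ k) (δ := δ / 2 * (1 / 2) ^ k)
      (by positivity) (by positivity)
  let D : ℕ → SmallerDist M := fun n => Nat.rec
    ⟨nndist, nndist_self, nndist_comm, nndist_triangle, fun _ _ => le_rfl, 1, one_pos, by simp⟩
    next n
  have hanti : ∀ x y, Antitone fun k => D k x y := fun x y =>
    antitone_nat_of_succ_le fun k => hle k (D k) x y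
  have hlow : ∀ k x, dist p x ≤ D k p x + δ * (1 - (1 / 2) ^ k) := by
    intro k x
    induction k with
    | zero => simp [D]
    | succ k ih =>
      have h : (D k p x : ℝ) ≤ D (k + 1) p x + δ / 2 * (1 / 2) ^ k := mod_cast hclose k (D k) x
      rw [pow_succ]
      linarith
  have hlim : ∀ x, Tendsto (fun k => (D k p x : ℝ)) atTop (𝓝 ↑(⨅ k, D k p x)) := fun x =>
    NNReal.tendsto_coe.2 (tendsto_atTop_ciInf (hanti p x) (OrderBot.bddBelow _))
  have hg : ∀ k x y, |((⨅ k, D k p x : ℝ≥0) : ℝ) - (⨅ k, D k p y : ℝ≥0)| ≤ D k x y := by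
    intro k x y
    refine le_of_tendsto (((hlim x).sub (hlim y)).abs) ?_
    filter_upwards [eventually_ge_atTop k] with m hm
    exact ((D m).abs_sub_le p x y).trans (mod_cast hanti x y hm)
  refine ⟨fun x => (⨅ k, D k p x : ℝ≥0), LipschitzWith.of_dist_le_mul fun x y => ?_, ?_, ?_⟩
  · rw [Real.dist_eq, NNReal.coe_one, one_mul]
    exact hg 0 x y
  · intro q
    rw [Metric.tendsto_nhds]
    intro ε hε
    obtain ⟨k, hk⟩ := exists_pow_lt_of_lt_one hε (show (1 / 2 : ℝ) < 1 by norm_num)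
    obtain ⟨r, hr, hflat'⟩ := hflat k (D k)
    have hnear : ∀ᶠ z : M × M in 𝓝 (q, q), dist z.1 z.2 < r :=
      (continuous_dist.tendsto (q, q)).eventually_lt_const (by simpa using hr)
    filter_upwards [mem_nhdsWithin_of_mem_nhds hnear, self_mem_nhdsWithin] with z hz hne
    have hpos : 0 < dist z.1 z.2 := dist_pos.2 hne
    have h : (D (k + 1) z.1 z.2 : ℝ) ≤ (1 / 2) ^ k * dist z.1 z.2 :=
      mod_cast hflat' z.1 z.2 (mod_cast hz)
    rw [Real.dist_0_eq_abs, abs_of_nonneg (by positivity), div_lt_iff₀ hpos]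
    calc _ ≤ (D (k + 1) z.1 z.2 : ℝ) := hg (k + 1) z.1 z.2
      _ ≤ _ := h
      _ < _ := by gcongr
  · intro x
    have h0 : (⨅ k, D k p p) = 0 := by simp [SmallerDist.self]
    have h : dist p x - δ ≤ (⨅ k, D k p x : ℝ≥0) := by
      refine ge_of_tendsto' (hlim x) fun k => ?_
      have : (0 : ℝ) ≤ δ * (1 / 2) ^ k := by positivity
      linarith [hlow k x]
    simpa [h0] using h

/-! ### Images of locally flat maps on the line -/

/-- A map from a set of reals that is `ε`-Lipschitz at a fixed small scale shrinks outer measure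
by `ε`. -/
lemma hausdorffMeasure_image_le_of_small_scale {X : Type*} [MetricSpace X] [MeasurableSpace X]
    [BorelSpace X] (γ : ℝ → X) (E : Set ℝ) (ε : ℝ≥0) {r : ℝ} (hr : 0 < r)
    (h : ∀ s ∈ E, ∀ t ∈ E, |s - t| < r → dist (γ s) (γ t) ≤ ε * |s - t|) :
    Measure.hausdorffMeasure 1 (γ '' E) ≤ ε * volume E := by
  let I : ℤ → Set ℝ := fun j => (fun t : ℝ => ⌊t / r⌋) ⁻¹' {j}
  have hImeas : ∀ j, MeasurableSet (I j) := fun j =>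
    (Int.measurable_floor.comp (measurable_id.div_const r)) (measurableSet_singleton j)
  have hIdisj : Pairwise (Function.onFun Disjoint I) := fun i j hij =>
    Disjoint.preimage _ (by simpa using hij)
  have hIunion : ⋃ j, I j = univ := by ext t; simp [I]
  have hIE : ∀ j, Measure.hausdorffMeasure 1 (γ '' (E ∩ I j)) ≤ ε * volume (E ∩ I j) := by
    intro j
    have hlip : LipschitzOnWith ε γ (E ∩ I j) := by
      refine LipschitzOnWith.of_dist_le_mul fun s hs t ht => ?_
      refine h s hs.1 t ht.1 ?_
      have hst : ⌊s / r⌋ = ⌊t / r⌋ := hs.2.trans ht.2.symm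
      have := Int.abs_sub_lt_one_of_floor_eq_floor hst
      rwa [← sub_div, abs_div, abs_of_pos hr, div_lt_one hr] at this
    simpa [hausdorffMeasure_real] using hlip.hausdorffMeasure_image_le zero_le_one
  calc Measure.hausdorffMeasure 1 (γ '' E)
      = Measure.hausdorffMeasure 1 (⋃ j, γ '' (E ∩ I j)) := by
        rw [← image_iUnion, ← inter_iUnion, hIunion, inter_univ]
    _ ≤ ∑' j, Measure.hausdorffMeasure 1 (γ '' (E ∩ I j)) := measure_iUnion_le _
    _ ≤ ∑' j, ε * volume (E ∩ I j) := ENNReal.tsum_le_tsum hIE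
    _ = ε * ∑' j, volume.restrict E (I j) := by
        rw [ENNReal.tsum_mul_left]
        simp_rw [Measure.restrict_apply (hImeas _), inter_comm]
    _ = ε * volume E := by
        rw [← measure_iUnion hIdisj hImeas, hIunion, Measure.restrict_apply_univ]

/-- A Sard type theorem: a map on a set of reals that is infinitesimally constant at each point
has an `H¹`-null image. -/
lemma hausdorffMeasure_image_eq_zero_of_flat {X : Type*} [MetricSpace X] [MeasurableSpace X]
    [BorelSpace X] (γ : ℝ → X) (E : Set ℝ)
    (h : ∀ t ∈ E, ∀ ε > 0, ∀ᶠ s in 𝓝[E] t, dist (γ s) (γ t) ≤ ε * |s - t|) :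
    Measure.hausdorffMeasure 1 (γ '' E) = 0 := by
  have hbdd : ∀ n : ℕ, Measure.hausdorffMeasure 1 (γ '' (E ∩ Metric.closedBall 0 n)) = 0 := by
    intro n
    set B := Metric.closedBall (0 : ℝ) n
    have hB : volume B ≠ ⊤ := measure_closedBall_lt_top.ne
    have hle : ∀ ε : ℝ≥0, 0 < ε → Measure.hausdorffMeasure 1 (γ '' (E ∩ B)) ≤ ε * volume B := by
      intro ε hε
      let Q : ℕ → Set ℝ := fun k =>
        {t ∈ E ∩ B | ∀ s ∈ E, |s - t| < 1 / ((k : ℝ) + 1) → dist (γ s) (γ t) ≤ ε * |s - t|}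
      have hQmono : Monotone Q := fun i j hij t ht =>
        ⟨ht.1, fun s hs hst => ht.2 s hs (hst.trans_le (Nat.one_div_le_one_div hij))⟩
      have hQunion : ⋃ k, Q k = E ∩ B := by
        refine Subset.antisymm (iUnion_subset fun k t ht => ht.1) fun t ht => ?_
        obtain ⟨r, hr, hball⟩ := Metric.mem_nhdsWithin_iff.1 (h t ht.1 ε hε)
        obtain ⟨k, hk⟩ := exists_nat_one_div_lt hr
        refine mem_iUnion.2 ⟨k, ht, fun s hs hst => hball ⟨?_, hs⟩⟩
        rw [Metric.mem_ball, Real.dist_eq]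
        exact hst.trans hk
      rw [← hQunion, image_iUnion,
        Monotone.measure_iUnion fun i j hij => image_mono (hQmono hij)]
      refine iSup_le fun k => ?_
      refine (hausdorffMeasure_image_le_of_small_scale γ (Q k) ε (r := 1 / ((k : ℝ) + 1))
        (by positivity) fun s hs t ht hst => ht.2 s hs.1.1 hst).trans ?_
      gcongr
      exact fun t ht => ht.1.2
    refine nonpos_iff_eq_zero.1 (ge_of_tendsto (x := 𝓝[>] (0 : ℝ≥0))
      (f := fun ε : ℝ≥0 => (ε : ENNReal) * volume B) ?_ ?_)
    · have := ENNReal.Tendsto.mul_const (b := volume B)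
        (ENNReal.tendsto_coe.2 (tendsto_id (α := ℝ≥0) (x := 𝓝 0))) (Or.inr hB)
      simpa using this.mono_left nhdsWithin_le_nhds
    · filter_upwards [self_mem_nhdsWithin] with ε hε using hle ε hε
  have hE : E = ⋃ n : ℕ, E ∩ Metric.closedBall 0 n := by
    rw [← inter_iUnion, Metric.iUnion_closedBall_nat, inter_univ]
  rw [hE, image_iUnion]
  exact measure_iUnion_null hbdd

/-- If a Lipschitz function is infinitesimally constant on `A`, it can grow only on the complement
of `A`. -/
lemma abs_sub_le_volume_uIcc_diff (H : ℝ → ℝ) (K : ℝ≥0) (hH : LipschitzWith K H) (A : Set ℝ)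
    (h : ∀ t ∈ A, ∀ ε > 0, ∀ᶠ s in 𝓝[A] t, dist (H s) (H t) ≤ ε * |s - t|) (a b : ℝ) :
    ENNReal.ofReal |H b - H a| ≤ K * volume (uIcc a b \ A) := by
  calc ENNReal.ofReal |H b - H a| = volume (uIcc (H a) (H b)) := Real.volume_interval.symm
    _ ≤ volume (H '' A ∪ H '' (uIcc a b \ A)) := by
        refine measure_mono ((intermediate_value_uIcc hH.continuous.continuousOn).trans ?_)
        rw [← image_union]
        exact image_mono fun t ht => by by_cases hA : t ∈ A <;> simp [hA, ht]
    _ ≤ volume (H '' A) + volume (H '' (uIcc a b \ A)) := measure_union_le _ _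
    _ ≤ 0 + K * volume (uIcc a b \ A) := by
        gcongr
        · rw [← hausdorffMeasure_real, hausdorffMeasure_image_eq_zero_of_flat H A h]
        · simpa [hausdorffMeasure_real] using
            hH.hausdorffMeasure_image_le zero_le_one (uIcc a b \ A)
    _ = _ := zero_add _

/-- Almost every point of a measurable set of reals is a density point, also in terms of one-sided
intervals. -/
lemma ae_eventually_volume_uIcc_diff_le {A : Set ℝ} (hA : MeasurableSet A) :
    ∀ᵐ t, t ∈ A → ∀ η : ℝ, 0 < η → ∀ᶠ s in 𝓝 t,
      volume (uIcc t s \ A) ≤ ENNReal.ofReal (η * |s - t|) := by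
  filter_upwards [Besicovitch.ae_tendsto_measure_inter_div_of_measurableSet volume hA.compl]
    with t ht htA η hη
  rw [indicator_of_notMem (by simpa using htA)] at ht
  have hev := ht.eventually_lt_const (u := ENNReal.ofReal (η / 2)) (by simpa using hη)
  have habs : Tendsto (fun s : ℝ => |s - t|) (𝓝[≠] t) (𝓝[>] 0) := by
    refine tendsto_nhdsWithin_iff.2 ⟨?_, ?_⟩
    · have : Tendsto (fun s : ℝ => |s - t|) (𝓝 t) (𝓝 |t - t|) :=
        (continuous_id.sub continuous_const).abs.tendsto t
      simpa using this.mono_left nhdsWithin_le_nhds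
    · filter_upwards [self_mem_nhdsWithin] with s hs
      exact abs_pos.2 (sub_ne_zero.2 hs)
  have hne : ∀ᶠ s in 𝓝[≠] t, volume (uIcc t s \ A) ≤ ENNReal.ofReal (η * |s - t|) := by
    filter_upwards [habs.eventually hev, self_mem_nhdsWithin] with s hs hst
    have hpos : 0 < |s - t| := abs_pos.2 (sub_ne_zero.2 hst)
    rw [Real.volume_closedBall, ENNReal.div_lt_iff (Or.inl (by simpa using sub_ne_zero.2 hst))
        (Or.inl ENNReal.ofReal_ne_top),
      ← ENNReal.ofReal_mul (by positivity)] at hs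
    refine (measure_mono fun u hu => ?_).trans (hs.le.trans_eq (by ring_nf))
    refine ⟨hu.2, ?_⟩
    rw [Metric.mem_closedBall, Real.dist_eq]
    exact abs_sub_left_of_mem_uIcc hu.1
  rw [eventually_nhdsWithin_iff] at hne
  filter_upwards [hne] with s hs
  rcases eq_or_ne s t with rfl | hst
  · simp [measure_mono_null sdiff_subset (measure_singleton s)]
  · exact hs hst

/-! ### Locally flat functions on rectifiable pieces -/

lemma IsLocallyFlat.eventually_dist_le {M : Type*} [MetricSpace M] {g : M → ℝ}
    (hg : IsLocallyFlat g) (p : M) {ε : ℝ} (hε : 0 < ε) :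
    ∀ᶠ x in 𝓝 p, dist (g x) (g p) ≤ ε * dist x p := by
  have h := (Metric.tendsto_nhds.1 (hg p)) ε hε
  rw [eventually_nhdsWithin_iff] at h
  have hc : Tendsto (fun x => (x, p)) (𝓝 p) (𝓝 (p, p)) :=
    (continuous_id.prodMk continuous_const).tendsto p
  filter_upwards [hc.eventually h] with x hx
  rcases eq_or_ne x p with rfl | hxp
  · simp
  · have h1 := hx hxp
    rw [Real.dist_0_eq_abs, abs_of_nonneg (by positivity), div_lt_iff₀ (dist_pos.2 hxp)] at h1
    exact h1.le

/-- A Lipschitz map from a set of reals to a complete space extends to the closure of the set. -/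
lemma exists_lipschitzOnWith_closure {M : Type*} [MetricSpace M] [CompleteSpace M] [Nonempty M]
    {A : Set ℝ} {f : A → M} {K : ℝ≥0} (hf : LipschitzWith K f) :
    ∃ γ : ℝ → M, LipschitzOnWith K γ (closure A) ∧ ∀ t : A, γ t = f t := by
  let f' : ℝ → M := Function.extend Subtype.val f fun _ => Classical.arbitrary M
  have hf' : ∀ t : A, f' t = f t := fun t => Subtype.val_injective.extend_apply _ _ t
  have hlip : LipschitzOnWith K f' A := fun s hs t ht => by
    rw [hf' ⟨s, hs⟩, hf' ⟨t, ht⟩]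
    exact hf ⟨s, hs⟩ ⟨t, ht⟩
  have hlim : ∀ t ∈ closure A, ∃ y, Tendsto f' (𝓝[A] t) (𝓝 y) := fun t ht => by
    have : (𝓝[A] t).NeBot := mem_closure_iff_nhdsWithin_neBot.1 ht
    have hc : Cauchy (𝓝[A] t) := cauchy_nhds.mono nhdsWithin_le_nhds
    exact CompleteSpace.complete (hc.map_of_le hlip.uniformContinuousOn inf_le_right)
  have heq : ∀ t ∈ A, extendFrom A f' t = f' t := fun t ht =>
    extendFrom_eq (subset_closure ht) (hlip.continuousOn t ht)
  refine ⟨extendFrom A f', LipschitzOnWith.closure (continuousOn_extendFrom Subset.rfl hlim) ?_,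
    fun t => (heq t t.2).trans (hf' t)⟩
  exact fun s hs t ht => by simpa only [heq s hs, heq t ht] using hlip hs ht

theorem LocallyFlatSeparatesPointsUniformly.isPurelyOneUnrectifiable {M : Type*} [MetricSpace M]
    [CompleteSpace M] [MeasurableSpace M] [BorelSpace M]
    (hM : LocallyFlatSeparatesPointsUniformly M) : IsPurelyOneUnrectifiable M := by
  intro A f K hf
  obtain ⟨C, -, hC⟩ := hM
  rcases isEmpty_or_nonempty M with hM | hM
  · simp [range_eq_empty_iff.2 (Function.isEmpty f)]
  obtain ⟨γ, hγ, hγf⟩ := exists_lipschitzOnWith_closure hf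
  set B := closure A
  have hB : MeasurableSet B := isClosed_closure.measurableSet
  -- A locally flat function grows along the curve only across the gaps of `B`, which are negligible
  -- near a density point `t`. As it is allowed to realize the distance from `γ s` to `γ t`, this
  -- distance is small compared with `|s - t|`.
  have hflat : ∀ t ∈ B, (∀ η : ℝ, 0 < η → ∀ᶠ s in 𝓝 t,
      volume (uIcc t s \ B) ≤ ENNReal.ofReal (η * |s - t|)) →
      ∀ ε > 0, ∀ᶠ s in 𝓝[B] t, dist (γ s) (γ t) ≤ ε * |s - t| := by
    intro t ht hdens ε hε
    filter_upwards [mem_nhdsWithin_of_mem_nhds (hdens (ε / (C * K + 1)) (by positivity)),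
      self_mem_nhdsWithin] with s hs hsB
    obtain ⟨g, hgC, hg, hgd⟩ := hC (γ s) (γ t)
    obtain ⟨H, hH, hHg⟩ := (hgC.comp_lipschitzOnWith hγ).extend_real
    have hHflat : ∀ u ∈ B, ∀ ε > 0, ∀ᶠ v in 𝓝[B] u, dist (H v) (H u) ≤ ε * |v - u| := by
      intro u hu ε hε
      have hlim : Tendsto γ (𝓝[B] u) (𝓝 (γ u)) := hγ.continuousOn u hu
      filter_upwards [hlim.eventually (hg.eventually_dist_le (γ u) (ε := ε / (K + 1))
        (by positivity)), self_mem_nhdsWithin] with v hv hvB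
      rw [← hHg hu, ← hHg hvB]
      calc dist (g (γ v)) (g (γ u)) ≤ ε / (K + 1) * dist (γ v) (γ u) := hv
        _ ≤ ε / (K + 1) * ((K + 1) * |v - u|) := by
            gcongr
            refine (hγ.dist_le_mul v hvB u hu).trans ?_
            rw [Real.dist_eq]
            gcongr
            linarith
        _ = ε * |v - u| := by field_simp
    have h := abs_sub_le_volume_uIcc_diff H (C * K) hH B hHflat t s
    rw [← hHg ht, ← hHg hsB] at h
    simp only [Function.comp_apply] at h
    rw [hgd, abs_of_nonneg dist_nonneg] at h
    have h2 : ENNReal.ofReal (dist (γ s) (γ t)) ≤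
        ENNReal.ofReal (C * K * (ε / (C * K + 1) * |s - t|)) := by
      rw [ENNReal.ofReal_mul (by positivity), ← NNReal.coe_mul, ENNReal.ofReal_coe_nnreal]
      exact h.trans (mul_le_mul_right hs _)
    rw [ENNReal.ofReal_le_ofReal_iff (by positivity)] at h2
    calc dist (γ s) (γ t) ≤ C * K / (C * K + 1) * (ε * |s - t|) := h2.trans_eq (by ring)
      _ ≤ 1 * (ε * |s - t|) := by
          gcongr
          rw [div_le_one (by positivity)]
          linarith
      _ = ε * |s - t| := one_mul _
  let N : Set ℝ := {t ∈ B | ∀ η : ℝ, 0 < η → ∀ᶠ s in 𝓝 t,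
      volume (uIcc t s \ B) ≤ ENNReal.ofReal (η * |s - t|)}
  have hNflat : Measure.hausdorffMeasure 1 (γ '' N) = 0 :=
    hausdorffMeasure_image_eq_zero_of_flat γ N fun t ht ε hε =>
      nhdsWithin_mono t (fun _ hs => hs.1) (hflat t ht.1 ht.2 ε hε)
  have hBN : volume (B \ N) = 0 := by
    refine measure_mono_null ?_ (ae_iff.1 (ae_eventually_volume_uIcc_diff_le hB))
    intro t ht hcon
    exact ht.2 ⟨ht.1, hcon ht.1⟩
  have hnull : Measure.hausdorffMeasure 1 (γ '' (B \ N)) = 0 := by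
    have := (hγ.mono sdiff_subset).hausdorffMeasure_image_le (s := B \ N) zero_le_one
    simpa [hausdorffMeasure_real, hBN] using this
  refine measure_mono_null ?_ (measure_union_null hNflat hnull)
  rintro _ ⟨t, rfl⟩
  rw [← image_union, ← hγf]
  refine mem_image_of_mem _ ?_
  by_cases ht : (t : ℝ) ∈ N
  · exact Or.inl ht
  · exact Or.inr ⟨subset_closure t.2, ht⟩

/-! ### Both directions combined -/

theorem theoremA (M : Type*) [MetricSpace M] [CompactSpace M]
    [MeasurableSpace M] [BorelSpace M] :
    (LocallyFlatSeparatesPointsUniformly M ↔ IsPurelyOneUnrectifiable M) ∧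
    (IsPurelyOneUnrectifiable M → ∀ (p : M) (δ : ℝ), 0 < δ →
      ∃ g : M → ℝ, LipschitzWith 1 g ∧ IsLocallyFlat g ∧
        ∀ x : M, g x - g p ≥ dist p x - δ) := by
  refine ⟨⟨fun h => h.isPurelyOneUnrectifiable, fun h => ⟨2, one_le_two, fun x y => ?_⟩⟩,
    fun h p δ hδ => h.exists_isLocallyFlat p hδ⟩
  rcases eq_or_ne x y with rfl | hxy
  · exact ⟨fun _ => 0, LipschitzWith.of_dist_le_mul (by simp), fun p => by simp [tendsto_const_nhds],
      by simp⟩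
  have hd : 0 < dist x y := dist_pos.2 hxy
  obtain ⟨g, hg1, hg, hgd⟩ := h.exists_isLocallyFlat y (half_pos hd)
  -- `g` separates `x` and `y` by at least half their distance; rescale it.
  have hgxy : dist x y / 2 ≤ g x - g y := by
    have := hgd x
    rw [dist_comm y x] at this
    linarith
  have hpos : 0 < g x - g y := by linarith
  set c := dist x y / (g x - g y)
  have hc0 : 0 ≤ c := by positivity
  have hc2 : c ≤ 2 := (div_le_iff₀ hpos).2 (by linarith)
  refine ⟨fun z => c * g z, LipschitzWith.of_dist_le_mul fun z w => ?_, fun p => ?_, ?_⟩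
  · have := hg1.dist_le_mul z w
    rw [Real.dist_eq, NNReal.coe_one, one_mul] at this
    rw [Real.dist_eq, ← mul_sub, abs_mul, abs_of_nonneg hc0]
    exact mul_le_mul hc2 this (abs_nonneg _) (by norm_num)
  · have := (hg p).const_mul c
    rw [mul_zero] at this
    refine this.congr fun z => ?_
    rw [← mul_sub, abs_mul, abs_of_nonneg hc0, mul_div_assoc]
  · rw [← mul_sub]
    exact div_mul_cancel₀ _ hpos.ne'
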